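/- For a prime $p$ write $\mathbb F_p$ for the field with $p$ elements and $e(t)=e^{2\pi i t/p}$ for $t\in\mathbb F_p$. For $f:\mathbb F_p^N\to\mathbb F_p$ and $y\in\mathbb F_p^N$ let $f_y(x)=f(x+y)-f(x)$, and let $f_{y_1\ldots y_k}=(f_{y_1\ldots y_{k-1}})_{y_k}$. For $k\ge 1$ the $k$-th Gowers norm of $f$ is $$\|f\|_{U^k}=\Big(\mathbb E_{x,y_1,\ldots,y_k\in\mathbb F_p^N}\, e\big(f_{y_1\ldots y_k}(x)\big)\Big)^{1/2^k},$$ where the average is a non-negative real number. Let $S_n(x)=\sum_{S\subseteq\{1,\ldots,N\},\,|S|=n}\prod_{i\in S}x_i$ be the elementary symmetric polynomial of degree $n$ in $N$ variables, viewed as a function $\mathbb F_p^N\to\mathbb F_p$. Then: 1. For every prime $p$ there is $\epsilon>0$, independent of $N$, such that $\|S_{2p}\|_{U^{p+2}}>\epsilon$ for all $N$. 2. In particular, for $p=2$, there is $\epsilon>0$, independent of $N$, such that $\|S_4\|_{U^4}>\epsilon$ for all $N$. 3. More generally, for every prime $p$ and every integer $n\ge 2p$ there is $\epsilon>0$, independent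 of $N$, such that $\|S_n\|_{U^{n-p+2}}>\epsilon$ for all $N$. -/

import Mathlib

open scoped BigOperators

/-- Iterated directional derivative `f_{y_1 ... y_k} = (f_{y_1 ... y_{k-1}})_{y_k}`, where
`f_y (x) = f (x + y) - f x` is `fwdDiff y f`. -/
def iteratedDirDeriv {A B : Type*} [AddCommGroup A] [AddCommGroup B] (f : A → B) :
    (k : ℕ) → (Fin k → A) → A → B
  | 0, _ => f
  | k + 1, y => fwdDiff (y (Fin.last k)) (iteratedDirDeriv f k (fun i => y i.castSucc))

/-- The average of `e (f_{y_1 ... y_k} (x))` over all `x, y_1, ..., y_k` in `F_p^N`, where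
`e (t) = exp (2 π i t / p)`. -/
noncomputable def gowersAverage {p N : ℕ} [NeZero p] (k : ℕ)
    (f : (Fin N → ZMod p) → ZMod p) : ℂ :=
  𝔼 q : (Fin N → ZMod p) × (Fin k → Fin N → ZMod p),
    ZMod.stdAddChar (iteratedDirDeriv f k q.2 q.1)

/-- The `k`-th Gowers norm of `f : F_p^N → F_p`, the `2^k`-th root of the average above. For
`k ≥ 1` that average is a non-negative real number (`gowersAverage_succ_nonneg`), so nothing is
lost in passing to the real part. -/
noncomputable def gowersNorm {p N : ℕ} [NeZero p] (k : ℕ)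
    (f : (Fin N → ZMod p) → ZMod p) : ℝ :=
  (gowersAverage k f).re ^ ((1 : ℝ) / 2 ^ k)

/-- The elementary symmetric polynomial `S_n` in `N` variables as a function `F_p^N → F_p`. -/
noncomputable def symFun (p N n : ℕ) (x : Fin N → ZMod p) : ZMod p :=
  MvPolynomial.eval x (MvPolynomial.esymm (Fin N) (ZMod p) n)

/-- The explicit form of `S_n`. -/
theorem symFun_eq (p N n : ℕ) (x : Fin N → ZMod p) :
    symFun p N n x = ∑ S ∈ Finset.powersetCard n Finset.univ, ∏ i ∈ S, x i := by
  simp [symFun, MvPolynomial.esymm]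

theorem expect_diff_eq_norm_sq {p N : ℕ} [NeZero p] (g : (Fin N → ZMod p) → ZMod p) :
    (𝔼 x : Fin N → ZMod p, 𝔼 z : Fin N → ZMod p, (ZMod.stdAddChar (g (x + z) - g x) : ℂ)) =
      ((‖𝔼 x : Fin N → ZMod p, (ZMod.stdAddChar (g x) : ℂ)‖ ^ 2 : ℝ) : ℂ) := by
  have hconj : (starRingEnd ℂ) (𝔼 x : Fin N → ZMod p, (ZMod.stdAddChar (g x) : ℂ)) =
      𝔼 x : Fin N → ZMod p, (ZMod.stdAddChar (-(g x)) : ℂ) := by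
    simp only [Finset.expect_eq_sum_div_card, map_div₀, map_sum, map_natCast,
      AddChar.map_neg_eq_conj]
  rw [← Complex.normSq_eq_norm_sq, ← Complex.mul_conj, mul_comm, hconj,
    Finset.expect_mul_expect]
  refine Finset.expect_congr rfl fun x _ => ?_
  refine Fintype.expect_equiv (Equiv.addLeft x) _ _ fun z => ?_
  rw [sub_eq_add_neg, AddChar.map_add_eq_mul, mul_comm]
  rfl

theorem gowersAverage_succ {p N : ℕ} [NeZero p] (k : ℕ) (f : (Fin N → ZMod p) → ZMod p) :
    gowersAverage (k + 1) f =
      ((𝔼 y : Fin k → Fin N → ZMod p,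
        ‖𝔼 x : Fin N → ZMod p, (ZMod.stdAddChar (iteratedDirDeriv f k y x) : ℂ)‖ ^ 2 : ℝ) : ℂ) := by
  have hy : ∀ x : Fin N → ZMod p,
      (𝔼 y : Fin (k + 1) → Fin N → ZMod p,
        (ZMod.stdAddChar (iteratedDirDeriv f (k + 1) y x) : ℂ)) =
      𝔼 q : (Fin N → ZMod p) × (Fin k → Fin N → ZMod p),
        (ZMod.stdAddChar (iteratedDirDeriv f k q.2 (x + q.1) - iteratedDirDeriv f k q.2 x) : ℂ) := by
    intro x
    refine (Fintype.expect_equiv (Fin.snocEquiv fun _ => (Fin N → ZMod p)) _ _ fun q => ?_).symm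
    simp [iteratedDirDeriv, fwdDiff, Fin.snocEquiv]
  have hprod : gowersAverage (k + 1) f = 𝔼 x : Fin N → ZMod p,
      𝔼 y : Fin (k + 1) → Fin N → ZMod p,
        (ZMod.stdAddChar (iteratedDirDeriv f (k + 1) y x) : ℂ) :=
    Finset.expect_product Finset.univ Finset.univ _
  rw [hprod, Complex.ofReal_expect]
  calc _ = 𝔼 x : Fin N → ZMod p, 𝔼 y : Fin k → Fin N → ZMod p, 𝔼 z : Fin N → ZMod p,
        (ZMod.stdAddChar (iteratedDirDeriv f k y (x + z) - iteratedDirDeriv f k y x) : ℂ) := by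
        refine Finset.expect_congr rfl fun x _ => (hy x).trans ?_
        exact (Finset.expect_product Finset.univ Finset.univ _).trans
          (Finset.expect_comm _ _ _)
    _ = _ := by
        refine (Finset.expect_comm _ _ _).trans ?_
        exact Finset.expect_congr rfl fun y _ => expect_diff_eq_norm_sq _

/-- The average in the definition of the Gowers norm is real and non-negative for `k ≥ 1`. -/
theorem gowersAverage_succ_nonneg {p N : ℕ} [NeZero p] (k : ℕ)
    (f : (Fin N → ZMod p) → ZMod p) :
    0 ≤ (gowersAverage (k + 1) f).re ∧ (gowersAverage (k + 1) f).im = 0 := by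
  rw [gowersAverage_succ]
  exact ⟨Finset.expect_nonneg fun _ _ => by positivity, Complex.ofReal_im _⟩

/-! Put `k = n - p + 1` and write the argument of `S_n` as a sum of `k + 1` vectors. Then `S_n (∑ j,
z j)` is the sum of the degree-`n` coefficients of `P = ∏ i, (1 + ℓ_i)`, where `ℓ_i = ∑ j, z_j(i)
X_j`. A coefficient whose exponent omits `X_j` does not depend on `z_j`. In the other exponents
every variable occurs, so every entry is at most `n - k = p - 1`.

These remaining coefficients depend on boundedly many values. Since `ℓ_i ^ p` lies in the ideal of
the `X_j ^ p`, modulo this ideal `X_j ∂_j P = L_j P` with `L_j` of degree at most `p`, and the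
recursion can be solved because entries in `1, ..., p - 1` are invertible. As `p < k + 1`, each
coefficient of `L_j` again ignores some `z_i`.

Fixing all coefficients of the `L_j` at a popular value therefore makes the phase of `S_n` a product
of functions each ignoring a variable, on a set of density bounded below independently of `N`. The
box inequality `norm_expect_phase_mul_prod_pow_le` turns this correlation into a bound for the
Gowers norm. -/

/-! ### Polarization of `S_n` and truncated logarithmic derivatives -/

section GeneratingPolynomial

open MvPolynomial Finset

variable {p k N : ℕ}

/-- The linear form `∑ j, z_j(i) X_j` attached to the `i`-th coordinates of `z_1, ..., z_k`. -/
noncomputable def coordForm (z : Fin k → Fin N → ZMod p) (i : Fin N) :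
    MvPolynomial (Fin k) (ZMod p) :=
  ∑ j, C (z j i) * X j

/-- The generating polynomial `∏ i, (1 + ∑ j, z_j(i) X_j)` of the polarizations of the elementary
symmetric polynomials. -/
noncomputable def polarGen (z : Fin k → Fin N → ZMod p) : MvPolynomial (Fin k) (ZMod p) :=
  ∏ i, (1 + coordForm z i)

/-- The truncation of the logarithmic derivative `X_j ∂_j log (polarGen z)` which is exact modulo
the ideal generated by the `X_i ^ p`. -/
noncomputable def truncLogDeriv (z : Fin k → Fin N → ZMod p) (j : Fin k) :
    MvPolynomial (Fin k) (ZMod p) :=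
  X j * ∑ i, C (z j i) * ∑ r ∈ range p, (-coordForm z i) ^ r

theorem MvPolynomial.coeff_X_pow_mul_eq_zero {σ R : Type*} [CommSemiring R] (i : σ) {d : ℕ}
    {a : σ →₀ ℕ} (h : a i < d) (q : MvPolynomial σ R) : coeff a (X i ^ d * q) = 0 := by
  classical
  rw [X_pow_eq_monomial, coeff_monomial_mul', if_neg]
  intro hle
  have := hle i
  simp at this
  omega

theorem MvPolynomial.coeff_eq_of_X_dvd_sub {σ R : Type*} [CommRing R] {i : σ}
    {a : σ →₀ ℕ} (h : a i = 0) {q q' : MvPolynomial σ R} (hq : X i ∣ q - q') :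
    coeff a q = coeff a q' := by
  obtain ⟨s, hs⟩ := hq
  rw [← sub_eq_zero, ← coeff_sub, hs, ← pow_one (X i),
    MvPolynomial.coeff_X_pow_mul_eq_zero i (by omega)]

theorem MvPolynomial.coeff_X_mul_pderiv {σ R : Type*} [CommSemiring R] (j : σ)
    (q : MvPolynomial σ R) (a : σ →₀ ℕ) : coeff a (X j * pderiv j q) = a j * coeff a q := by
  classical
  rw [coeff_X_mul']
  split_ifs with h
  · have h1 : 1 ≤ a j := Nat.one_le_iff_ne_zero.2 (Finsupp.mem_support_iff.1 h)
    have h2 : a - Finsupp.single j 1 + Finsupp.single j 1 = a :=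
      tsub_add_cancel_of_le (Finsupp.single_le_iff.2 h1)
    rw [coeff_pderiv, h2, mul_comm]
    congr 1
    rw [← Nat.cast_add_one]
    congr 1
    simp
    omega
  · rw [Finsupp.notMem_support_iff] at h
    simp [h]

theorem Derivation.leibniz_finset_prod {R A M ι : Type*} [CommSemiring R] [CommSemiring A]
    [AddCommMonoid M] [Algebra R A] [Module A M] [Module R M] [DecidableEq ι]
    (D : Derivation R A M) (s : Finset ι) (f : ι → A) :
    D (∏ i ∈ s, f i) = ∑ i ∈ s, (∏ i' ∈ s.erase i, f i') • D (f i) := by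
  induction s using Finset.induction_on with
  | empty => simp
  | insert a s ha ih =>
    rw [prod_insert ha, D.leibniz, ih, sum_insert ha, erase_insert ha, add_comm, smul_sum]
    congr 1
    refine sum_congr rfl fun i hi => ?_
    have hne : a ≠ i := fun h => ha (h ▸ hi)
    rw [erase_insert_of_ne hne, prod_insert fun h => ha (mem_of_mem_erase h), smul_smul]

theorem coordForm_mk_update (z : Fin k → Fin N → ZMod p) (j : Fin k) (v : Fin N → ZMod p)
    (i : Fin N) :
    Ideal.Quotient.mk (Ideal.span {X j}) (coordForm (Function.update z j v) i) =
      Ideal.Quotient.mk (Ideal.span {(X j : MvPolynomial (Fin k) (ZMod p))}) (coordForm z i) := by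
  simp only [coordForm, map_sum, map_mul]
  refine sum_congr rfl fun l _ => ?_
  by_cases h : l = j
  · subst h
    have : Ideal.Quotient.mk (Ideal.span {(X l : MvPolynomial (Fin k) (ZMod p))}) (X l) = 0 :=
      Ideal.Quotient.eq_zero_iff_mem.2 (Ideal.mem_span_singleton_self _)
    rw [this, mul_zero, mul_zero]
  · rw [Function.update_of_ne h]

/-- Modulo `X j` the linear forms do not see `z j`. -/
theorem coeff_polarGen_update (z : Fin k → Fin N → ZMod p) {j : Fin k} (v : Fin N → ZMod p)
    {a : Fin k →₀ ℕ} (h : a j = 0) :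
    coeff a (polarGen (Function.update z j v)) = coeff a (polarGen z) := by
  refine MvPolynomial.coeff_eq_of_X_dvd_sub h ?_
  rw [← Ideal.mem_span_singleton, ← Ideal.Quotient.mk_eq_mk_iff_sub_mem]
  simp only [polarGen, map_prod, map_add, map_one, coordForm_mk_update]

theorem coeff_truncLogDeriv_update (z : Fin k → Fin N → ZMod p) (l : Fin k) {j : Fin k}
    (v : Fin N → ZMod p) {a : Fin k →₀ ℕ} (h : a j = 0) :
    coeff a (truncLogDeriv (Function.update z j v) l) = coeff a (truncLogDeriv z l) := by
  refine MvPolynomial.coeff_eq_of_X_dvd_sub h ?_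
  by_cases hl : l = j
  · subst hl
    exact dvd_sub (dvd_mul_right _ _) (dvd_mul_right _ _)
  · rw [← Ideal.mem_span_singleton, ← Ideal.Quotient.mk_eq_mk_iff_sub_mem]
    simp only [truncLogDeriv, map_mul, map_sum, map_pow, map_neg, coordForm_mk_update,
      Function.update_of_ne hl]

theorem coordForm_isHomogeneous (z : Fin k → Fin N → ZMod p) (i : Fin N) :
    (coordForm z i).IsHomogeneous 1 :=
  IsHomogeneous.sum _ _ _ fun j _ => by
    simpa using (isHomogeneous_C _ (z j i)).mul (isHomogeneous_X _ j)

theorem totalDegree_truncLogDeriv_le [Fact p.Prime] (z : Fin k → Fin N → ZMod p) (j : Fin k) :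
    (truncLogDeriv z j).totalDegree ≤ p := by
  have hp : 1 ≤ p := (Fact.out : p.Prime).one_le
  have h : (∑ i, C (z j i) * ∑ r ∈ range p, (-coordForm z i) ^ r).totalDegree ≤ p - 1 := by
    refine totalDegree_finsetSum_le fun i _ => (totalDegree_mul _ _).trans ?_
    rw [totalDegree_C, zero_add]
    refine totalDegree_finsetSum_le fun r hr => (totalDegree_pow _ _).trans ?_
    rw [totalDegree_neg]
    have h1 := (coordForm_isHomogeneous z i).totalDegree_le
    have h2 := mem_range.1 hr
    nlinarith [Nat.sub_add_cancel hp]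
  refine (totalDegree_mul _ _).trans ?_
  rw [totalDegree_X]
  omega

theorem coordForm_pow_char [Fact p.Prime] (z : Fin k → Fin N → ZMod p) (i : Fin N) :
    coordForm z i ^ p = ∑ j, X j ^ p * C (z j i) := by
  rw [coordForm, sum_pow_char]
  refine sum_congr rfl fun j _ => ?_
  rw [mul_pow, ← C_pow, ZMod.pow_card, mul_comm]

theorem pderiv_coordForm (z : Fin k → Fin N → ZMod p) (i : Fin N) (j : Fin k) :
    pderiv j (coordForm z i) = C (z j i) := by
  simp [coordForm, pderiv_X, Pi.single_apply]

/-- The geometric series for `1 / (1 + ℓ_i)` can be cut at `r < p`: its error carries `ℓ_i ^ p`,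
which by Frobenius is a combination of the `X_l ^ p` and so does not reach exponents with all
entries below `p`. -/
theorem coeff_X_mul_pderiv_polarGen [Fact p.Prime] (z : Fin k → Fin N → ZMod p) (j : Fin k)
    {a : Fin k →₀ ℕ} (ha : ∀ i, a i < p) :
    coeff a (X j * pderiv j (polarGen z)) = coeff a (truncLogDeriv z j * polarGen z) := by
  have hE : pderiv j (polarGen z) =
      ∑ i, (∏ i' ∈ univ.erase i, (1 + coordForm z i')) * C (z j i) := by
    rw [polarGen, Derivation.leibniz_finset_prod]
    refine sum_congr rfl fun i _ => ?_
    rw [map_add, pderiv_coordForm, pderiv_one, zero_add, smul_eq_mul]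
  have hgeom : ∀ i, ∏ i' ∈ univ.erase i, (1 + coordForm z i') =
      (∑ r ∈ range p, (-coordForm z i) ^ r) * polarGen z +
        (-1) ^ p * (∑ l, X l ^ p * C (z l i)) * ∏ i' ∈ univ.erase i, (1 + coordForm z i') := by
    intro i
    have h1 := mul_neg_geom_sum (-coordForm z i) p
    have h2 : polarGen z = (1 + coordForm z i) * ∏ i' ∈ univ.erase i, (1 + coordForm z i') :=
      (mul_prod_erase _ _ (mem_univ i)).symm
    rw [neg_pow (coordForm z i) p, coordForm_pow_char] at h1
    rw [h2]
    linear_combination (-∏ i' ∈ univ.erase i, (1 + coordForm z i')) * h1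
  have hsplit : X j * pderiv j (polarGen z) = truncLogDeriv z j * polarGen z +
      ∑ l, X l ^ p * (X j * ∑ i, C (z j i) * ((-1) ^ p * C (z l i) *
        ∏ i' ∈ univ.erase i, (1 + coordForm z i'))) := by
    have h3 : ∑ l, X l ^ p * (X j * ∑ i, C (z j i) * ((-1) ^ p * C (z l i) *
        ∏ i' ∈ univ.erase i, (1 + coordForm z i'))) =
        X j * ∑ i, C (z j i) * ((-1) ^ p * (∑ l, X l ^ p * C (z l i)) *
          ∏ i' ∈ univ.erase i, (1 + coordForm z i')) := by
      simp only [mul_sum, sum_mul]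
      rw [sum_comm]
      refine sum_congr rfl fun i _ => sum_congr rfl fun l _ => ?_
      ring
    rw [h3, hE, truncLogDeriv, mul_assoc, ← mul_add, sum_mul, ← sum_add_distrib]
    congr 1
    refine sum_congr rfl fun i _ => ?_
    linear_combination C (z j i) * hgeom i
  rw [hsplit, coeff_add, coeff_sum, sum_eq_zero, add_zero]
  exact fun l _ => MvPolynomial.coeff_X_pow_mul_eq_zero l (ha l) _

/-- The coefficients of `polarGen z` at exponents below `p` are determined by the truncated
logarithmic derivatives of `polarGen z`. -/
theorem coeff_polarGen_eq_of_truncLogDeriv_eq [Fact p.Prime] {z z' : Fin k → Fin N → ZMod p}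
    (h : ∀ j, truncLogDeriv z j = truncLogDeriv z' j) {a : Fin k →₀ ℕ} (ha : ∀ i, a i < p) :
    coeff a (polarGen z) = coeff a (polarGen z') := by
  induction hd : a.degree using Nat.strong_induction_on generalizing a with
  | _ d ih =>
    by_cases h0 : a = 0
    · have h1 : ∀ w : Fin k → Fin N → ZMod p, coeff 0 (polarGen w) = 1 := fun w => by
        simp [← constantCoeff_eq, polarGen, coordForm, map_prod, map_sum]
      rw [h0, h1, h1]
    · obtain ⟨j, hj⟩ := Finsupp.ne_iff.1 h0
      -- This is where entries below `p` are needed: the Euler operator `X_j ∂_j` multiplies the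
      -- coefficient by `a j`, which can be cancelled.
      have hj' : (a j : ZMod p) ≠ 0 := by
        rw [Ne, ZMod.natCast_eq_zero_iff]
        exact Nat.not_dvd_of_pos_of_lt (Nat.pos_of_ne_zero hj) (ha j)
      refine mul_left_cancel₀ hj' ?_
      rw [← MvPolynomial.coeff_X_mul_pderiv, ← MvPolynomial.coeff_X_mul_pderiv,
        coeff_X_mul_pderiv_polarGen z j ha, coeff_X_mul_pderiv_polarGen z' j ha, ← h j,
        coeff_mul, coeff_mul]
      refine sum_congr rfl fun x hx => ?_
      have hx' : x.1 + x.2 = a := mem_antidiagonal.1 hx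
      -- The factor `X j` kills the constant term of `truncLogDeriv`, so only coefficients of
      -- `polarGen` of strictly smaller degree enter the recursion.
      by_cases h1 : x.1 = 0
      · have : coeff x.1 (truncLogDeriv z j) = 0 := by
          rw [truncLogDeriv, ← pow_one (X j),
            MvPolynomial.coeff_X_pow_mul_eq_zero j (by simp [h1])]
        rw [this, zero_mul, zero_mul]
      · congr 1
        refine ih x.2.degree ?_ (fun i => ?_) rfl
        · have h2 : x.1.degree ≠ 0 := fun h2 => h1 ((Finsupp.degree_eq_zero_iff _).1 h2)
          rw [← hd, ← hx', map_add]
          omega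
        · refine lt_of_le_of_lt ?_ (ha i)
          rw [← hx']
          simp

theorem symFun_sum_eq_sum_coeff_polarGen (n : ℕ) (z : Fin k → Fin N → ZMod p) :
    symFun p N n (∑ j, z j) = ∑ a ∈ finsuppAntidiag univ n, coeff a (polarGen z) := by
  have hform : ∀ i, eval (fun _ => (1 : ZMod p)) (coordForm z i) = (∑ j, z j) i := fun i => by
    simp [coordForm]
  have hcomp : homogeneousComponent n (polarGen z) =
      ∑ S ∈ powersetCard n univ, ∏ i ∈ S, coordForm z i := by
    rw [polarGen, prod_one_add, map_sum, powersetCard_eq_filter, sum_filter]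
    refine sum_congr rfl fun S _ => ?_
    have hS : (∏ i ∈ S, coordForm z i).IsHomogeneous #S := by
      simpa using IsHomogeneous.prod S _ (fun _ => 1) fun i _ => coordForm_isHomogeneous z i
    rw [homogeneousComponent_of_mem ((mem_homogeneousSubmodule _ _).2 hS)]
    exact if_congr eq_comm rfl rfl
  have heval : symFun p N n (∑ j, z j) =
      eval (fun _ => (1 : ZMod p)) (homogeneousComponent n (polarGen z)) := by
    rw [symFun_eq, hcomp, map_sum]
    simp only [map_prod, hform]
  rw [heval, homogeneousComponent_apply, map_sum]
  simp only [eval_monomial, one_pow, Finsupp.prod, prod_const_one, mul_one]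
  refine sum_subset (fun a ha => ?_) fun a ha ha' => ?_
  · rw [mem_filter] at ha
    rw [mem_finsuppAntidiag]
    exact ⟨by rw [← ha.2, Finsupp.degree_eq_sum], subset_univ _⟩
  · rw [mem_finsuppAntidiag] at ha
    by_contra hne
    exact ha' (mem_filter.2 ⟨mem_support_iff.2 hne, by rw [Finsupp.degree_eq_sum]; exact ha.1⟩)

end GeneratingPolynomial

/-! ### The Gowers–Cauchy–Schwarz inequality -/

section BoxInequality

open Finset

theorem pow_expect_le_expect_pow {ι : Type*} [Fintype ι] [Nonempty ι] {f : ι → ℝ}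
    (hf : ∀ i, 0 ≤ f i) (n : ℕ) : (𝔼 i, f i) ^ n ≤ 𝔼 i, f i ^ n := by
  have h := Real.pow_arith_mean_le_arith_mean_pow univ (fun _ : ι => (Fintype.card ι : ℝ)⁻¹) f
    (fun _ _ => by positivity) (by simp) (fun i _ => hf i) n
  simpa only [Fintype.expect_eq_sum_div_card, div_eq_inv_mul, ← mul_sum] using h

theorem norm_sq_expect_eq_expect_expect {A : Type*} [AddCommGroup A] [Fintype A] (F : A → ℂ) :
    ((‖𝔼 w, F w‖ ^ 2 : ℝ) : ℂ) = 𝔼 w, 𝔼 h, F (w + h) * starRingEnd ℂ (F w) := by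
  have hconj : starRingEnd ℂ (𝔼 w, F w) = 𝔼 w, starRingEnd ℂ (F w) := by
    simp only [Finset.expect_eq_sum_div_card, map_div₀, map_sum, map_natCast]
  rw [← Complex.normSq_eq_norm_sq, ← Complex.mul_conj, mul_comm, hconj, Finset.expect_mul_expect]
  refine expect_congr rfl fun w _ => ?_
  refine (Fintype.expect_equiv (Equiv.addLeft w) _ _ fun h => ?_).symm
  rw [mul_comm]
  rfl

theorem iteratedDirDeriv_comp_add_right {A B : Type*} [AddCommGroup A] [AddCommGroup B]
    (f : A → B) (w : A) (k : ℕ) (y : Fin k → A) (x : A) :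
    iteratedDirDeriv (fun x => f (x + w)) k y x = iteratedDirDeriv f k y (x + w) := by
  induction k generalizing x with
  | zero => rfl
  | succ k ih => simp only [iteratedDirDeriv, fwdDiff, ih, add_right_comm]

theorem iteratedDirDeriv_fwdDiff {A B : Type*} [AddCommGroup A] [AddCommGroup B]
    (f : A → B) (h : A) (k : ℕ) (y : Fin k → A) (x : A) :
    iteratedDirDeriv (fwdDiff h f) k y x =
      iteratedDirDeriv f k y (x + h) - iteratedDirDeriv f k y x := by
  induction k generalizing x with
  | zero => rfl
  | succ k ih =>
    simp only [iteratedDirDeriv, fwdDiff] at ih ⊢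
    rw [ih, ih, add_right_comm]
    abel

variable {p N : ℕ} [NeZero p]

theorem gowersAverage_comp_add_right (k : ℕ) (f : (Fin N → ZMod p) → ZMod p)
    (w : Fin N → ZMod p) : gowersAverage k (fun x => f (x + w)) = gowersAverage k f := by
  refine Fintype.expect_equiv ((Equiv.addRight w).prodCongr (Equiv.refl _)) _ _ fun q => ?_
  rw [iteratedDirDeriv_comp_add_right]
  rfl

theorem gowersAverage_succ_eq_expect_fwdDiff (k : ℕ) (f : (Fin N → ZMod p) → ZMod p) :
    gowersAverage (k + 1) f = 𝔼 h, gowersAverage k (fwdDiff h f) := by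
  have h1 : gowersAverage (k + 1) f =
      𝔼 q : ((Fin N → ZMod p) × (Fin k → Fin N → ZMod p)) × (Fin N → ZMod p),
        (ZMod.stdAddChar (iteratedDirDeriv (fwdDiff q.2 f) k q.1.2 q.1.1) : ℂ) := by
    refine (Fintype.expect_equiv
      (((Equiv.prodAssoc _ _ _).trans ((Equiv.refl _).prodCongr
        ((Equiv.prodComm _ _).trans (Fin.snocEquiv fun _ => (Fin N → ZMod p)))))) _ _
        fun q => ?_).symm
    rw [iteratedDirDeriv_fwdDiff]
    simp [iteratedDirDeriv, fwdDiff, Fin.snocEquiv]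
  rw [h1]
  refine (Finset.expect_product univ univ _).trans ?_
  rw [expect_comm]
  rfl

/-- The normalized box (Gowers–Cauchy–Schwarz) inequality: the average of the phase of
`f (z_0 + ... + z_k)` against functions each of which ignores one of the variables is controlled
by the Gowers norm of `f`. -/
theorem norm_expect_phase_mul_prod_pow_le (k : ℕ) (f : (Fin N → ZMod p) → ZMod p)
    (b : Fin (k + 1) → (Fin (k + 1) → Fin N → ZMod p) → ℂ) (hb : ∀ i z, ‖b i z‖ ≤ 1)
    (hupd : ∀ i z v, b i (Function.update z i v) = b i z) :
    ‖𝔼 z : Fin (k + 1) → Fin N → ZMod p, (ZMod.stdAddChar (f (∑ j, z j)) : ℂ) * ∏ i, b i z‖ ^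
      2 ^ (k + 1) ≤ (gowersAverage (k + 1) f).re := by
  induction k generalizing f with
  | zero =>
    have h1 : (𝔼 z : Fin 1 → Fin N → ZMod p,
        (ZMod.stdAddChar (f (∑ j, z j)) : ℂ) * ∏ i, b i z) =
        (𝔼 x : Fin N → ZMod p, (ZMod.stdAddChar (f x) : ℂ)) * b 0 0 := by
      rw [expect_mul]
      refine Fintype.expect_equiv (Equiv.funUnique (Fin 1) _) _ _ fun z => ?_
      have : b 0 z = b 0 0 := by
        rw [← hupd 0 0 (z 0)]
        congr 1
        ext i : 1
        rw [Subsingleton.elim i 0]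
        simp
      simp [this]
    rw [h1, gowersAverage_succ, Complex.ofReal_re, norm_mul]
    have h2 : ∀ y : Fin 0 → Fin N → ZMod p,
        ‖𝔼 x : Fin N → ZMod p, (ZMod.stdAddChar (iteratedDirDeriv f 0 y x) : ℂ)‖ ^ 2 =
        ‖𝔼 x : Fin N → ZMod p, (ZMod.stdAddChar (f x) : ℂ)‖ ^ 2 := fun y => rfl
    rw [expect_congr rfl fun y _ => h2 y, Fintype.expect_const]
    exact pow_le_pow_left₀ (by positivity)
      (mul_le_of_le_one_right (norm_nonneg _) (hb 0 0)) 2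
  | succ k ih =>
    let B : (Fin (k + 1) → (Fin N → ZMod p)) → (Fin N → ZMod p) → ℂ := fun z w =>
      ∏ i : Fin (k + 1), b i.castSucc (Fin.snoc (α := fun _ => (Fin N → ZMod p)) z w)
    let F : (Fin (k + 1) → (Fin N → ZMod p)) → (Fin N → ZMod p) → ℂ := fun z w =>
      (ZMod.stdAddChar (f (∑ j, z j + w)) : ℂ) * B z w
    have hsnoc : (𝔼 z : Fin (k + 1 + 1) → (Fin N → ZMod p),
        (ZMod.stdAddChar (f (∑ j, z j)) : ℂ) * ∏ i, b i z) =
        𝔼 z, (𝔼 w, F z w) * b (Fin.last _) (Fin.snoc z 0) := by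
      have h1 : (𝔼 z : Fin (k + 1 + 1) → (Fin N → ZMod p),
          (ZMod.stdAddChar (f (∑ j, z j)) : ℂ) * ∏ i, b i z) =
          𝔼 q : (Fin N → ZMod p) × (Fin (k + 1) → Fin N → ZMod p),
            F q.2 q.1 * b (Fin.last _) (Fin.snoc q.2 0) := by
        refine (Fintype.expect_equiv (Fin.snocEquiv fun _ => (Fin N → ZMod p)) _ _ fun q => ?_).symm
        have h2 : b (Fin.last _) (Fin.snoc q.2 0) =
            b (Fin.last _) (Fin.snoc (α := fun _ => (Fin N → ZMod p)) q.2 q.1) := by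
          rw [← hupd _ (Fin.snoc q.2 0) q.1, Fin.update_snoc_last]
        rw [h2]
        simp only [F, B, Fin.snocEquiv, Equiv.coe_fn_mk, Fin.sum_univ_castSucc (n := k + 1),
          Fin.prod_univ_castSucc (n := k + 1), Fin.snoc_castSucc, Fin.snoc_last, mul_assoc]
      rw [h1]
      refine (Finset.expect_product univ univ _).trans ?_
      rw [expect_comm]
      simp only [expect_mul]
    -- The last factor ignores `w`, so it leaves the inner average and its bound by 1 removes it.
    have hCS : ‖𝔼 z : Fin (k + 1 + 1) → (Fin N → ZMod p),
        (ZMod.stdAddChar (f (∑ j, z j)) : ℂ) * ∏ i, b i z‖ ^ 2 ≤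
        𝔼 z : Fin (k + 1) → Fin N → ZMod p, ‖𝔼 w : Fin N → ZMod p, F z w‖ ^ 2 := by
      rw [hsnoc]
      refine le_trans ?_ (pow_expect_le_expect_pow (fun _ => norm_nonneg _) 2)
      refine pow_le_pow_left₀ (norm_nonneg _) ?_ 2
      refine (RCLike.norm_expect_le (K := ℂ)).trans (expect_le_expect fun z _ => ?_)
      rw [norm_mul]
      exact mul_le_of_le_one_right (norm_nonneg _) (hb _ _)
    -- Expanding the square doubles each remaining factor; for fixed `w` and `h` the product still
    -- ignores its own variable, and `f` is replaced by `fwdDiff h f`.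
    let c : (Fin N → ZMod p) → (Fin N → ZMod p) → Fin (k + 1) →
        (Fin (k + 1) → Fin N → ZMod p) → ℂ := fun w h i z =>
      b i.castSucc (Fin.snoc (α := fun _ => Fin N → ZMod p) z (w + h)) *
        starRingEnd ℂ (b i.castSucc (Fin.snoc (α := fun _ => Fin N → ZMod p) z w))
    let G : (Fin N → ZMod p) → (Fin N → ZMod p) → ℂ := fun w h =>
      𝔼 z : Fin (k + 1) → Fin N → ZMod p,
        (ZMod.stdAddChar (fwdDiff h f (∑ j, z j + w)) : ℂ) * ∏ i, c w h i z
    have hsq : ((𝔼 z, ‖𝔼 w, F z w‖ ^ 2 : ℝ) : ℂ) = 𝔼 w, 𝔼 h, G w h := by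
      rw [Complex.ofReal_expect, expect_congr rfl fun z _ => norm_sq_expect_eq_expect_expect (F z),
        expect_comm]
      refine expect_congr rfl fun w _ => ?_
      rw [expect_comm]
      refine expect_congr rfl fun h _ => expect_congr rfl fun z _ => ?_
      simp only [F, B, c, fwdDiff, map_mul, map_prod, prod_mul_distrib, sub_eq_add_neg,
        AddChar.map_add_eq_mul, AddChar.map_neg_eq_conj, add_assoc]
      ring
    have hG : ∀ w h, ‖G w h‖ ^ 2 ^ (k + 1) ≤ (gowersAverage (k + 1) (fwdDiff h f)).re := by
      intro w h
      have h1 := ih (fun x => fwdDiff h f (x + w)) (c w h) (fun i z => ?_) fun i z v => ?_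
      · rwa [gowersAverage_comp_add_right (k + 1) (fwdDiff h f) w] at h1
      · simp only [c]
        rw [norm_mul, RCLike.norm_conj]
        exact mul_le_one₀ (hb _ _) (norm_nonneg _) (hb _ _)
      · simp only [c, Fin.snoc_update, hupd]
    have hle : (𝔼 z, ‖𝔼 w, F z w‖ ^ 2) ≤
        𝔼 q : (Fin N → ZMod p) × (Fin N → ZMod p), ‖G q.1 q.2‖ := by
      have h0 : (0 : ℝ) ≤ 𝔼 z, ‖𝔼 w, F z w‖ ^ 2 := expect_nonneg fun _ _ => by positivity
      rw [← abs_of_nonneg h0, ← Real.norm_eq_abs, ← Complex.norm_real, hsq]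
      have : (𝔼 w, 𝔼 h, G w h) = 𝔼 q : (Fin N → ZMod p) × (Fin N → ZMod p), G q.1 q.2 :=
        (Finset.expect_product univ univ fun q : _ × _ => G q.1 q.2).symm
      rw [this]
      exact RCLike.norm_expect_le (K := ℂ)
    calc _ = (‖𝔼 z : Fin (k + 1 + 1) → (Fin N → ZMod p),
          (ZMod.stdAddChar (f (∑ j, z j)) : ℂ) * ∏ i, b i z‖ ^ 2) ^ 2 ^ (k + 1) := by
          rw [← pow_mul, ← pow_succ']
      _ ≤ (𝔼 q : _ × _, ‖G q.1 q.2‖) ^ 2 ^ (k + 1) := by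
          gcongr
          exact hCS.trans hle
      _ ≤ 𝔼 q : _ × _, ‖G q.1 q.2‖ ^ 2 ^ (k + 1) :=
          pow_expect_le_expect_pow (fun _ => norm_nonneg _) _
      _ ≤ 𝔼 q : _ × _, (gowersAverage (k + 1) (fwdDiff q.2 f)).re :=
          expect_le_expect fun q _ => hG q.1 q.2
      _ = 𝔼 _ : Fin N → ZMod p, 𝔼 h, (gowersAverage (k + 1) (fwdDiff h f)).re :=
          Finset.expect_product univ univ fun q : _ × _ =>
            (gowersAverage (k + 1) (fwdDiff q.2 f)).re
      _ = (gowersAverage (k + 1 + 1) f).re := by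
          rw [Fintype.expect_const, gowersAverage_succ_eq_expect_fwdDiff]
          simp only [Fintype.expect_eq_sum_div_card, Complex.div_natCast_re, Complex.re_sum]

end BoxInequality

/-! ### Pigeonholing and the lower bound -/

section LowerBound

open Finset

/-- A product of `1`-bounded functions, each of which ignores one of the `k` variables. -/
def IsDegenerateProduct {k : ℕ} {V : Type*} (u : (Fin k → V) → ℂ) : Prop :=
  ∃ b : Fin k → (Fin k → V) → ℂ, (∀ i z, ‖b i z‖ ≤ 1) ∧
    (∀ i z v, b i (Function.update z i v) = b i z) ∧ ∀ z, u z = ∏ i, b i z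

theorem isDegenerateProduct_of_update_eq {k : ℕ} {V : Type*} {u : (Fin k → V) → ℂ} (i : Fin k)
    (hu : ∀ z, ‖u z‖ ≤ 1) (hupd : ∀ z v, u (Function.update z i v) = u z) :
    IsDegenerateProduct u := by
  refine ⟨fun j z => if j = i then u z else 1, fun j z => ?_, fun j z v => ?_, fun z => by simp⟩
  · dsimp only
    split_ifs
    exacts [hu z, by simp]
  · dsimp only
    split_ifs with h
    exacts [h ▸ hupd z v, rfl]

theorem IsDegenerateProduct.mul {k : ℕ} {V : Type*} {u u' : (Fin k → V) → ℂ}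
    (hu : IsDegenerateProduct u) (hu' : IsDegenerateProduct u') :
    IsDegenerateProduct fun z => u z * u' z := by
  obtain ⟨b, h1, h2, h3⟩ := hu
  obtain ⟨b', h1', h2', h3'⟩ := hu'
  refine ⟨fun i z => b i z * b' i z, fun i z => ?_, fun i z v => by simp only [h2, h2'],
    fun z => by simp only [h3, h3', prod_mul_distrib]⟩
  rw [norm_mul]
  exact mul_le_one₀ (h1 _ _) (norm_nonneg _) (h1' _ _)

theorem IsDegenerateProduct.prod {k : ℕ} {V ι : Type*} (s : Finset ι)
    {u : ι → (Fin k → V) → ℂ} (hu : ∀ x ∈ s, IsDegenerateProduct (u x)) :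
    IsDegenerateProduct fun z => ∏ x ∈ s, u x z := by
  classical
  induction s using Finset.induction_on with
  | empty => exact ⟨fun _ _ => 1, by simp, by simp, by simp⟩
  | insert a s ha ih =>
    simp only [prod_insert ha]
    exact (hu a (mem_insert_self _ _)).mul (ih fun x hx => hu x (mem_insert_of_mem hx))

theorem norm_expect_phase_mul_pow_le {p N : ℕ} [NeZero p] (k : ℕ)
    (f : (Fin N → ZMod p) → ZMod p) {u : (Fin (k + 1) → Fin N → ZMod p) → ℂ}
    (hu : IsDegenerateProduct u) :
    ‖𝔼 z : Fin (k + 1) → Fin N → ZMod p, (ZMod.stdAddChar (f (∑ j, z j)) : ℂ) * u z‖ ^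
      2 ^ (k + 1) ≤ (gowersAverage (k + 1) f).re := by
  obtain ⟨b, h1, h2, h3⟩ := hu
  simp only [h3]
  exact norm_expect_phase_mul_prod_pow_le k f b h1 h2

/-- Pigeonhole: the fibre densities average to `1 / card T`, and a fibre at least that dense is
nonempty. -/
theorem exists_inv_card_le_expect_fiber {Z T : Type*} [Fintype Z] [Nonempty Z] [Fintype T]
    [DecidableEq T] (P : Z → T) :
    ∃ z₀, (Fintype.card T : ℝ)⁻¹ ≤ 𝔼 z, if P z = P z₀ then (1 : ℝ) else 0 := by
  have : Nonempty T := ‹Nonempty Z›.map P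
  have h : (𝔼 v : T, 𝔼 z : Z, if P z = v then (1 : ℝ) else 0) = (Fintype.card T : ℝ)⁻¹ := by
    rw [expect_comm]
    simp
  obtain ⟨v, -, hv⟩ := exists_le_of_le_expect univ_nonempty h.ge
  by_cases hz : ∃ z₀, P z₀ = v
  · obtain ⟨z₀, rfl⟩ := hz
    exact ⟨z₀, hv⟩
  · push Not at hz
    simp only [hz, if_false, expect_const_zero] at hv
    exact absurd hv (by simp)

/-- The exponents in `k` variables of total degree at most `p`. -/
def boundedExponents (k p : ℕ) : Finset (Fin k →₀ ℕ) :=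
  (range (p + 1)).biUnion fun d => finsuppAntidiag univ d

theorem mem_boundedExponents {k p : ℕ} {a : Fin k →₀ ℕ} :
    a ∈ boundedExponents k p ↔ a.degree ≤ p := by
  simp [boundedExponents, Finsupp.degree_eq_sum]

theorem exists_eq_zero_of_degree_lt {k : ℕ} {a : Fin k →₀ ℕ} (h : a.degree < k) :
    ∃ i, a i = 0 := by
  by_contra! hne
  have h1 : ∑ _i : Fin k, 1 ≤ ∑ i, a i := sum_le_sum fun i _ => Nat.one_le_iff_ne_zero.2 (hne i)
  rw [Finsupp.degree_eq_sum] at h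
  simp at h1
  omega

theorem add_card_le_degree_succ {k : ℕ} {a : Fin k →₀ ℕ} (h : ∀ i, a i ≠ 0) (i : Fin k) :
    a i + k ≤ a.degree + 1 := by
  have h1 : ∑ _j ∈ univ.erase i, 1 ≤ ∑ j ∈ univ.erase i, a j :=
    sum_le_sum fun j _ => Nat.one_le_iff_ne_zero.2 (h j)
  rw [Finsupp.degree_eq_sum, ← add_sum_erase _ _ (mem_univ i)]
  simp at h1
  omega

theorem norm_stdAddChar {p : ℕ} [NeZero p] (t : ZMod p) : ‖(ZMod.stdAddChar t : ℂ)‖ = 1 :=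
  AddChar.norm_apply _ _

theorem AddChar.map_finset_sum_eq_prod {A M ι : Type*} [AddCommMonoid A] [CommMonoid M]
    (ψ : AddChar A M) (s : Finset ι) (f : ι → A) : ψ (∑ i ∈ s, f i) = ∏ i ∈ s, ψ (f i) := by
  classical
  induction s using Finset.induction_on with
  | empty => simp
  | insert a s ha ih => rw [sum_insert ha, prod_insert ha, AddChar.map_add_eq_mul, ih]

/-- The coefficients of low degree of the truncated logarithmic derivatives. -/
noncomputable def truncLogDerivCoeffs {p k N : ℕ} (z : Fin k → Fin N → ZMod p) :
    Fin k × boundedExponents k p → ZMod p :=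
  fun q => MvPolynomial.coeff q.2.1 (truncLogDeriv z q.1)

theorem truncLogDeriv_eq_of_coeffs_eq {p k N : ℕ} [Fact p.Prime]
    {z z' : Fin k → Fin N → ZMod p} (h : truncLogDerivCoeffs z = truncLogDerivCoeffs z')
    (j : Fin k) : truncLogDeriv z j = truncLogDeriv z' j := by
  ext a
  by_cases ha : a.degree ≤ p
  · exact congrFun h (j, ⟨a, mem_boundedExponents.2 ha⟩)
  · have h0 : ∀ w : Fin k → Fin N → ZMod p, MvPolynomial.coeff a (truncLogDeriv w j) = 0 :=
      fun w => MvPolynomial.coeff_eq_zero_of_totalDegree_lt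
        ((totalDegree_truncLogDeriv_le w j).trans_lt (not_le.1 ha))
    rw [h0, h0]

theorem inv_card_pow_le_gowersAverage_symFun {p k : ℕ} [Fact p.Prime] (hk : p ≤ k) {n : ℕ}
    (hn : n ≤ k + p - 1) (N : ℕ) :
    (Fintype.card (Fin (k + 1) × boundedExponents (k + 1) p → ZMod p) : ℝ)⁻¹ ^ 2 ^ (k + 1) ≤
      (gowersAverage (k + 1) (symFun p N n)).re := by
  classical
  obtain ⟨z₀, hz₀⟩ := exists_inv_card_le_expect_fiber
    (truncLogDerivCoeffs (p := p) (k := k + 1) (N := N))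
  set D := {a ∈ finsuppAntidiag (univ : Finset (Fin (k + 1))) n | ∃ i, a i = 0}
  set D' := {a ∈ finsuppAntidiag (univ : Finset (Fin (k + 1))) n | ¬ ∃ i, a i = 0} with hD'
  -- `u₁` is the indicator of the popular fibre, and `u₂` cancels the phases of the coefficients
  -- omitting a variable.
  let u₁ : (Fin (k + 1) → Fin N → ZMod p) → ℂ := fun z =>
    ∏ q, if truncLogDerivCoeffs z q = truncLogDerivCoeffs z₀ q then 1 else 0
  let u₂ : (Fin (k + 1) → Fin N → ZMod p) → ℂ := fun z =>
    ∏ a ∈ D, (ZMod.stdAddChar (-(polarGen z).coeff a) : ℂ)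
  have hu₁ : IsDegenerateProduct u₁ := by
    refine IsDegenerateProduct.prod _ fun q _ => ?_
    obtain ⟨i, hi⟩ := exists_eq_zero_of_degree_lt
      (lt_of_le_of_lt (mem_boundedExponents.1 q.2.2) (Nat.lt_succ_of_le hk))
    refine isDegenerateProduct_of_update_eq i (fun z => ?_) fun z v => ?_
    · split_ifs <;> simp
    · have h : truncLogDerivCoeffs (Function.update z i v) q = truncLogDerivCoeffs z q :=
        coeff_truncLogDeriv_update z q.1 v hi
      rw [h]
  have hu₂ : IsDegenerateProduct u₂ := by
    refine IsDegenerateProduct.prod _ fun a ha => ?_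
    obtain ⟨i, hi⟩ := (mem_filter.1 ha).2
    refine isDegenerateProduct_of_update_eq i (fun z => (norm_stdAddChar _).le) fun z v => ?_
    rw [coeff_polarGen_update z v hi]
  have hconst : ∀ z, (ZMod.stdAddChar (symFun p N n (∑ j, z j)) : ℂ) * (u₁ z * u₂ z) =
      (ZMod.stdAddChar (∑ a ∈ D', (polarGen z₀).coeff a) : ℂ) *
        ((if truncLogDerivCoeffs z = truncLogDerivCoeffs z₀ then 1 else 0 : ℝ) : ℂ) := by
    intro z
    by_cases hz : truncLogDerivCoeffs z = truncLogDerivCoeffs z₀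
    · have h1 : u₁ z = 1 := prod_eq_one fun q _ => if_pos (congrFun hz q)
      have h2 : u₂ z = ZMod.stdAddChar (-∑ a ∈ D, (polarGen z).coeff a) := by
        rw [← sum_neg_distrib, AddChar.map_finset_sum_eq_prod]
      have h3 : ∑ a ∈ D', (polarGen z).coeff a = ∑ a ∈ D', (polarGen z₀).coeff a := by
        refine sum_congr rfl fun a ha => coeff_polarGen_eq_of_truncLogDeriv_eq
          (truncLogDeriv_eq_of_coeffs_eq hz) fun i => ?_
        rw [hD', mem_filter, mem_finsuppAntidiag] at ha
        -- All `k + 1` entries are positive with sum `n ≤ k + p - 1`, which forces `a i ≤ n - k <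
        -- p`.
        have h4 := add_card_le_degree_succ (fun i hi => ha.2 ⟨i, hi⟩) i
        rw [Finsupp.degree_eq_sum, ha.1.1] at h4
        have := (Fact.out : p.Prime).pos
        omega
      rw [h1, h2, one_mul, ← AddChar.map_add_eq_mul, if_pos hz, Complex.ofReal_one, mul_one,
        symFun_sum_eq_sum_coeff_polarGen, ← h3,
        ← sum_filter_add_sum_filter_not (finsuppAntidiag univ n) (fun a => ∃ i, a i = 0)]
      congr 1
      abel
    · obtain ⟨q, hq⟩ := Function.ne_iff.1 hz
      have h1 : u₁ z = 0 := prod_eq_zero (mem_univ q) (if_neg hq)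
      rw [h1, if_neg hz, Complex.ofReal_zero, zero_mul, mul_zero, mul_zero]
  refine le_trans ?_ (norm_expect_phase_mul_pow_le k (symFun p N n) (hu₁.mul hu₂))
  rw [expect_congr rfl fun z _ => hconst z, ← mul_expect, ← Complex.ofReal_expect, norm_mul,
    norm_stdAddChar, one_mul, Complex.norm_real]
  exact pow_le_pow_left₀ (by positivity) (hz₀.trans (le_abs_self _)) _

theorem exists_lt_gowersNorm_symFun (p : ℕ) [Fact p.Prime] (n : ℕ) (hn : 2 * p ≤ n) :
    ∃ ε : ℝ, 0 < ε ∧ ∀ N : ℕ, ε < gowersNorm (n - p + 2) (symFun p N n) := by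
  set c : ℝ := (Fintype.card
    (Fin (n - p + 1 + 1) × boundedExponents (n - p + 1 + 1) p → ZMod p) : ℝ)⁻¹ with hc
  have hc0 : 0 < c := inv_pos.2 (Nat.cast_pos.2 Fintype.card_pos)
  -- The norm is at least `c`; halving makes the inequality strict.
  refine ⟨c / 2, half_pos hc0, fun N => (half_lt_self hc0).trans_le ?_⟩
  have h := inv_card_pow_le_gowersAverage_symFun (p := p) (k := n - p + 1) (by omega) (n := n)
    (by omega) N
  rw [← hc] at h
  calc c = (c ^ 2 ^ (n - p + 2)) ^ ((1 : ℝ) / 2 ^ (n - p + 2)) := by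
        have := Real.pow_rpow_inv_natCast hc0.le (n := 2 ^ (n - p + 2)) (by positivity)
        rw [one_div]
        exact_mod_cast this.symm
    _ ≤ _ := Real.rpow_le_rpow (by positivity) h (by positivity)

end LowerBound

theorem theorem1p2 :
    (∀ (p : ℕ) [Fact p.Prime], ∃ ε : ℝ, 0 < ε ∧
      ∀ N : ℕ, ε < gowersNorm (p + 2) (symFun p N (2 * p))) ∧
    (∃ ε : ℝ, 0 < ε ∧ ∀ N : ℕ, ε < gowersNorm 4 (symFun 2 N 4)) ∧
    (∀ (p : ℕ) [Fact p.Prime] (n : ℕ), 2 * p ≤ n → ∃ ε : ℝ, 0 < ε ∧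
      ∀ N : ℕ, ε < gowersNorm (n - p + 2) (symFun p N n)) := by
  refine ⟨fun p _ => ?_, exists_lt_gowersNorm_symFun 2 4 le_rfl, exists_lt_gowersNorm_symFun⟩
  have h := exists_lt_gowersNorm_symFun p (2 * p) le_rfl
  rwa [show 2 * p - p = p by omega] at h
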